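/- For each $n\ge 1$ let $\lambda^{(n)}$ be a random vector that is uniformly distributed (with respect to normalized $(n-1)$-dimensional surface measure) on the scaled simplex $\{\lambda\in\mathbb{R}^n : \lambda_j\ge 0 \text{ for all } j,\ \sum_j\lambda_j=n\}$, and let $U^{(n)}$ be a random matrix that is independent of $\lambda^{(n)}$ and distributed according to the normalized Haar measure on the orthogonal group $O(n)=\{U\in\mathbb{R}^{n\times n} : U^\top U=I_n\}$. Put $\Sigma^{(n)}=U^{(n)}\,\mathrm{diag}\bigl(\lambda^{(n)}\bigr)\,{U^{(n)}}^\top$. Then, as $n\to\infty$, $\Sigma^{(n)}$ converges to the identity matrix $I_n$ entrywise in probability, uniformly over the position of the entry: for every $\varepsilon>0$, $$\lim_{n\to\infty}\ \max_{1\le j,k\le n}\ \Pr\left\{\bigl|\Sigma^{(n)}_{j,k}-(I_n)_{j,k}\bigr|\ge\varepsilon\right\}=0 .$$ -/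

import Mathlib

open MeasureTheory ProbabilityTheory Filter Topology
open scoped Matrix

/-- The scaled simplex `{λ ∈ ℝⁿ : λ ≥ 0, ∑ λ_j = n}`, as a subset of Euclidean space. -/
def scaledSimplex (n : ℕ) : Set (EuclideanSpace ℝ (Fin n)) :=
  {x | (∀ j, 0 ≤ x j) ∧ ∑ j, x j = n}

/-- The orthogonal group `O(n)` carries the Borel σ-algebra of its topology as a set of
real matrices. -/
instance orthogonalGroupMeasurableSpace (n : ℕ) :
    MeasurableSpace (Matrix.orthogonalGroup (Fin n) ℝ) :=
  borel _

instance orthogonalGroupBorelSpace (n : ℕ) :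
    BorelSpace (Matrix.orthogonalGroup (Fin n) ℝ) :=
  ⟨rfl⟩

/-- A random vector is uniform on the scaled simplex if its law is the normalized
`(n - 1)`-dimensional Hausdorff measure (surface measure) restricted to the simplex. -/
def IsUniformOnSimplex {Ω : Type*} [MeasurableSpace Ω] (P : Measure Ω) {n : ℕ}
    (X : Ω → EuclideanSpace ℝ (Fin n)) : Prop :=
  Measurable X ∧ pdf.IsUniform X (scaledSimplex n) P (Measure.euclideanHausdorffMeasure (n - 1))

/-- A random orthogonal matrix is uniform on `O(n)` if its law is the Haar measure of `O(n)`
(normalized, as soon as `P` is a probability measure). -/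
def IsUniformOnOrthogonalGroup {Ω : Type*} [MeasurableSpace Ω] (P : Measure Ω) {n : ℕ}
    (U : Ω → Matrix.orthogonalGroup (Fin n) ℝ) : Prop :=
  Measurable U ∧ (P.map U).IsHaarMeasure

/-- The covariance matrix `U diag(λ) Uᵀ`. -/
def covMatrix {n : ℕ} (U : Matrix.orthogonalGroup (Fin n) ℝ) (l : EuclideanSpace ℝ (Fin n)) :
    Matrix (Fin n) (Fin n) ℝ :=
  (U : Matrix (Fin n) (Fin n) ℝ) * Matrix.diagonal (fun j => l j) *
    (U : Matrix (Fin n) (Fin n) ℝ)ᵀ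

/-! Chebyshev's inequality with a second moment. Row orthonormality gives `Σ_jk - δ_jk = ∑ i, U_ji
U_ki (λ_i - 1)`, so by independence its second moment pairs the covariances of `λ` with fourth
moments of `U`. Exchangeability and `∑ λ_i = n` make the covariance matrix of `λ` equal to `v
n/(n-1)` times the identity minus `v/(n-1)` times the all-ones matrix, where `v` is the variance of
a coordinate. The all-ones part contributes a nonpositive amount and is dropped. The rest is at most
`2v · ∑ i, E[U_ji² U_ki²]`.

Neither law is computed explicitly. Left invariance under a 45° rotation of two rows bounds the
fourth-moment sum by `6/(n+4)` (`sum_integral_orthogonalGroup_sq_mul_sq_le`). Scaling of Hausdorff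
measure gives the tail bound `simplexLaw_tail_le`, hence `v ≤ t n + n² (1-t)^(n-1)` for every `t` in
`[0,1)`. The product is at most `12 (t + n (1-t)^(n-1))`; let `n → ∞`, with `t` arbitrarily small.
-/

/-! ### Fourth moments of Haar orthogonal matrices -/

section Orthogonal

variable {n : ℕ}

theorem continuous_orthogonalGroup_entry (j i : Fin n) :
    Continuous fun U : Matrix.orthogonalGroup (Fin n) ℝ => (U : Matrix (Fin n) (Fin n) ℝ) j i :=
  (continuous_subtype_val.matrix_elem j i)

theorem abs_orthogonalGroup_entry_le_one (U : Matrix.orthogonalGroup (Fin n) ℝ) (j i : Fin n) :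
    |(U : Matrix (Fin n) (Fin n) ℝ) j i| ≤ 1 :=
  entry_norm_bound_of_unitary U.2 j i

theorem sum_orthogonalGroup_row_mul_row (U : Matrix.orthogonalGroup (Fin n) ℝ) (j k : Fin n) :
    ∑ i, (U : Matrix (Fin n) (Fin n) ℝ) j i * (U : Matrix (Fin n) (Fin n) ℝ) k i =
      (1 : Matrix (Fin n) (Fin n) ℝ) j k := by
  rw [← (Matrix.mem_orthogonalGroup_iff _ _).1 U.2, Matrix.mul_apply]
  rfl

theorem sum_orthogonalGroup_col_sq (U : Matrix.orthogonalGroup (Fin n) ℝ) (i : Fin n) :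
    ∑ j, (U : Matrix (Fin n) (Fin n) ℝ) j i ^ 2 = 1 := by
  have h := congrFun (congrFun ((Matrix.mem_orthogonalGroup_iff' _ _).1 U.2) i) i
  rw [Matrix.mul_apply, Matrix.one_apply_eq] at h
  simpa [sq] using h

/-- The orthogonal matrix replacing the rows `j`, `k` of a matrix by their sum and
difference, each divided by `√2`. -/
theorem exists_orthogonalGroup_mix {j k : Fin n} (hjk : j ≠ k) :
    ∃ R : Matrix.orthogonalGroup (Fin n) ℝ, ∀ U : Matrix.orthogonalGroup (Fin n) ℝ, ∀ i,
      ((R * U : Matrix.orthogonalGroup (Fin n) ℝ) : Matrix (Fin n) (Fin n) ℝ) j i =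
        (√2)⁻¹ * ((U : Matrix (Fin n) (Fin n) ℝ) j i + (U : Matrix (Fin n) (Fin n) ℝ) k i) ∧
      ((R * U : Matrix.orthogonalGroup (Fin n) ℝ) : Matrix (Fin n) (Fin n) ℝ) k i =
        (√2)⁻¹ * ((U : Matrix (Fin n) (Fin n) ℝ) j i - (U : Matrix (Fin n) (Fin n) ℝ) k i) := by
  have hs : (√2)⁻¹ * (√2)⁻¹ = (1 / 2 : ℝ) := by
    rw [← mul_inv, Real.mul_self_sqrt (by norm_num)]; norm_num
  let r : Fin n → Fin n → ℝ := fun a =>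
    if a = j then (√2)⁻¹ • (Pi.single j 1 + Pi.single k 1)
    else if a = k then (√2)⁻¹ • (Pi.single j 1 - Pi.single k 1) else Pi.single a 1
  have hR : Matrix.of r ∈ Matrix.orthogonalGroup (Fin n) ℝ := by
    rw [Matrix.mem_orthogonalGroup_iff]
    ext a b
    change r a ⬝ᵥ r b = _
    have hkj := hjk.symm
    by_cases haj : a = j <;> by_cases hak : a = k <;> by_cases hbj : b = j <;>
      by_cases hbk : b = k <;> simp_all [r, Matrix.one_apply, Pi.single_apply, eq_comm]
    all_goals linarith
  refine ⟨⟨Matrix.of r, hR⟩, fun U i => ⟨?_, ?_⟩⟩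
  · change r j ⬝ᵥ (fun l => (U : Matrix (Fin n) (Fin n) ℝ) l i) = _
    simp [r, add_dotProduct, mul_add]
  · change r k ⬝ᵥ (fun l => (U : Matrix (Fin n) (Fin n) ℝ) l i) = _
    simp [r, sub_dotProduct, mul_sub, hjk.symm]

variable (ρ : Measure (Matrix.orthogonalGroup (Fin n) ℝ))

theorem integrable_orthogonalGroup_monomial [IsFiniteMeasure ρ] (j k i l : Fin n) (a b c d : ℕ) :
    Integrable (fun U : Matrix.orthogonalGroup (Fin n) ℝ =>
      (U : Matrix (Fin n) (Fin n) ℝ) j i ^ a * (U : Matrix (Fin n) (Fin n) ℝ) k i ^ b *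
      ((U : Matrix (Fin n) (Fin n) ℝ) j l ^ c * (U : Matrix (Fin n) (Fin n) ℝ) k l ^ d)) ρ := by
  refine Integrable.of_bound (C := 1) ?_ (ae_of_all _ fun U => ?_)
  · exact ((((continuous_orthogonalGroup_entry j i).pow a).mul
      ((continuous_orthogonalGroup_entry k i).pow b)).mul
      (((continuous_orthogonalGroup_entry j l).pow c).mul
      ((continuous_orthogonalGroup_entry k l).pow d))).measurable.aestronglyMeasurable
  · have h (p q : Fin n) (m : ℕ) : |(U : Matrix (Fin n) (Fin n) ℝ) p q| ^ m ≤ 1 :=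
      pow_le_one₀ (abs_nonneg _) (abs_orthogonalGroup_entry_le_one U p q)
    rw [Real.norm_eq_abs, abs_mul, abs_mul, abs_mul, abs_pow, abs_pow, abs_pow, abs_pow]
    exact mul_le_one₀ (mul_le_one₀ (h ..) (by positivity) (h ..)) (by positivity)
      (mul_le_one₀ (h ..) (by positivity) (h ..))

theorem integrable_orthogonalGroup_pow [IsFiniteMeasure ρ] (j i : Fin n) (a : ℕ) :
    Integrable (fun U : Matrix.orthogonalGroup (Fin n) ℝ =>
      (U : Matrix (Fin n) (Fin n) ℝ) j i ^ a) ρ := by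
  simpa using integrable_orthogonalGroup_monomial ρ j j i i a 0 0 0

theorem integrable_orthogonalGroup_sq_mul_sq [IsFiniteMeasure ρ] (j k i : Fin n) :
    Integrable (fun U : Matrix.orthogonalGroup (Fin n) ℝ =>
      (U : Matrix (Fin n) (Fin n) ℝ) j i ^ 2 * (U : Matrix (Fin n) (Fin n) ℝ) k i ^ 2) ρ := by
  simpa using integrable_orthogonalGroup_monomial ρ j k i i 2 2 0 0

/-- Apply invariance under the row mixing to `a⁴ + b⁴`, using `((a+b)⁴ + (a-b)⁴)/4 = (a⁴ + b⁴)/2 +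
3a²b²`. -/
theorem integral_orthogonalGroup_sq_mul_sq [IsFiniteMeasure ρ] [ρ.IsMulLeftInvariant]
    {j k : Fin n} (hjk : j ≠ k) (i : Fin n) :
    ∫ U, (U : Matrix (Fin n) (Fin n) ℝ) j i ^ 2 * (U : Matrix (Fin n) (Fin n) ℝ) k i ^ 2 ∂ρ =
      (∫ U, (U : Matrix (Fin n) (Fin n) ℝ) j i ^ 4 ∂ρ +
        ∫ U, (U : Matrix (Fin n) (Fin n) ℝ) k i ^ 4 ∂ρ) / 6 := by
  obtain ⟨R, hR⟩ := exists_orthogonalGroup_mix hjk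
  have hs : (√2)⁻¹ ^ 4 = (1 / 4 : ℝ) := by
    rw [inv_pow, show (4 : ℕ) = 2 * 2 from rfl, pow_mul, Real.sq_sqrt (by norm_num)]; norm_num
  have h := integral_mul_left_eq_self (μ := ρ) (fun U : Matrix.orthogonalGroup (Fin n) ℝ =>
    (U : Matrix (Fin n) (Fin n) ℝ) j i ^ 4 + (U : Matrix (Fin n) (Fin n) ℝ) k i ^ 4) R
  have e (U : Matrix.orthogonalGroup (Fin n) ℝ) :
      ((R * U : Matrix.orthogonalGroup (Fin n) ℝ) : Matrix (Fin n) (Fin n) ℝ) j i ^ 4 +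
      ((R * U : Matrix.orthogonalGroup (Fin n) ℝ) : Matrix (Fin n) (Fin n) ℝ) k i ^ 4 =
      (1 / 2) * ((U : Matrix (Fin n) (Fin n) ℝ) j i ^ 4 +
        (U : Matrix (Fin n) (Fin n) ℝ) k i ^ 4) + 3 *
        ((U : Matrix (Fin n) (Fin n) ℝ) j i ^ 2 * (U : Matrix (Fin n) (Fin n) ℝ) k i ^ 2) := by
    rw [(hR U i).1, (hR U i).2, mul_pow, mul_pow, hs]
    ring
  have i1 := integrable_orthogonalGroup_pow ρ j i 4
  have i2 := integrable_orthogonalGroup_pow ρ k i 4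
  have i3 := integrable_orthogonalGroup_sq_mul_sq ρ j k i
  simp_rw [e] at h
  rw [integral_add ((i1.fun_add i2).const_mul _) (i3.const_mul _), integral_const_mul,
    integral_const_mul, integral_add i1 i2] at h
  linarith

/-- Rows and columns have unit norm, so `U_ji² U_ki²` sums to 1 over all `k`, `i`. With `S k` the
fourth-moment sum of row `k`, the mixing identity turns this into `(n+4) S j + ∑ k, S k = 6`, and
the nonnegative total is discarded. -/
theorem sum_integral_orthogonalGroup_pow_four_le [IsProbabilityMeasure ρ] [ρ.IsMulLeftInvariant]
    (j : Fin n) :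
    ∑ i, ∫ U, (U : Matrix (Fin n) (Fin n) ℝ) j i ^ 4 ∂ρ ≤ 6 / (n + 4) := by
  set S : Fin n → ℝ := fun j => ∑ i, ∫ U, (U : Matrix (Fin n) (Fin n) ℝ) j i ^ 4 ∂ρ with hS
  have hS0 (k) : 0 ≤ S k := Finset.sum_nonneg fun i _ => integral_nonneg fun U => by positivity
  have hone : ∑ k, ∑ i, ∫ U, (U : Matrix (Fin n) (Fin n) ℝ) j i ^ 2 *
      (U : Matrix (Fin n) (Fin n) ℝ) k i ^ 2 ∂ρ = 1 := by
    rw [Finset.sum_comm]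
    simp_rw [← integral_finsetSum Finset.univ
      (fun k _ => integrable_orthogonalGroup_sq_mul_sq ρ j k _), ← Finset.mul_sum,
      sum_orthogonalGroup_col_sq, mul_one]
    rw [← integral_finsetSum Finset.univ (fun i _ => integrable_orthogonalGroup_pow ρ j i 2)]
    have (U : Matrix.orthogonalGroup (Fin n) ℝ) :
        ∑ i, (U : Matrix (Fin n) (Fin n) ℝ) j i ^ 2 = 1 := by
      simpa [sq] using sum_orthogonalGroup_row_mul_row U j j
    simp [this]
  have hk (k) (hk : k ∈ Finset.univ.erase j) : ∑ i, ∫ U, (U : Matrix (Fin n) (Fin n) ℝ) j i ^ 2 *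
      (U : Matrix (Fin n) (Fin n) ℝ) k i ^ 2 ∂ρ = (S j + S k) / 6 := by
    simp_rw [integral_orthogonalGroup_sq_mul_sq ρ (Finset.ne_of_mem_erase hk).symm, hS]
    rw [← Finset.sum_div, Finset.sum_add_distrib]
  have hj : ∑ i, ∫ U, (U : Matrix (Fin n) (Fin n) ℝ) j i ^ 2 *
      (U : Matrix (Fin n) (Fin n) ℝ) j i ^ 2 ∂ρ = S j := by
    simp_rw [hS, ← pow_add]
  rw [← Finset.add_sum_erase _ _ (Finset.mem_univ j), hj, Finset.sum_congr rfl hk,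
    ← Finset.sum_div, Finset.sum_add_distrib, Finset.sum_const,
    Finset.card_erase_of_mem (Finset.mem_univ j), Finset.card_univ, Fintype.card_fin, nsmul_eq_mul,
    Nat.cast_sub (show 1 ≤ n from j.pos), Nat.cast_one] at hone
  have hT : S j + ∑ k ∈ Finset.univ.erase j, S k = ∑ k, S k :=
    Finset.add_sum_erase _ _ (Finset.mem_univ j)
  have hT' : 0 ≤ ∑ k, S k := Finset.sum_nonneg fun k _ => hS0 k
  rw [le_div_iff₀ (by positivity)]
  change S j * _ ≤ 6
  linarith

/-- By `2a²b² ≤ a⁴ + b⁴`, which also covers `j = k`. -/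
theorem sum_integral_orthogonalGroup_sq_mul_sq_le [IsProbabilityMeasure ρ]
    [ρ.IsMulLeftInvariant] (j k : Fin n) :
    ∑ i, ∫ U, (U : Matrix (Fin n) (Fin n) ℝ) j i ^ 2 *
      (U : Matrix (Fin n) (Fin n) ℝ) k i ^ 2 ∂ρ ≤ 6 / (n + 4) := by
  have h (i : Fin n) : ∫ U, (U : Matrix (Fin n) (Fin n) ℝ) j i ^ 2 *
      (U : Matrix (Fin n) (Fin n) ℝ) k i ^ 2 ∂ρ ≤
      (1 / 2) * (∫ U, (U : Matrix (Fin n) (Fin n) ℝ) j i ^ 4 ∂ρ +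
        ∫ U, (U : Matrix (Fin n) (Fin n) ℝ) k i ^ 4 ∂ρ) := by
    have i1 := integrable_orthogonalGroup_pow ρ j i 4
    have i2 := integrable_orthogonalGroup_pow ρ k i 4
    rw [← integral_add i1 i2, ← integral_const_mul]
    refine integral_mono (integrable_orthogonalGroup_sq_mul_sq ρ j k i) ((i1.add i2).const_mul _)
      fun U => ?_
    simp only []
    nlinarith [sq_nonneg ((U : Matrix (Fin n) (Fin n) ℝ) j i ^ 2 -
      (U : Matrix (Fin n) (Fin n) ℝ) k i ^ 2)]
  refine (Finset.sum_le_sum fun i _ => h i).trans ?_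
  rw [← Finset.mul_sum, Finset.sum_add_distrib]
  linarith [sum_integral_orthogonalGroup_pow_four_le ρ j,
    sum_integral_orthogonalGroup_pow_four_le ρ k]

end Orthogonal

/-! ### Moments and tails of the uniform law on the simplex -/

section Simplex

variable {n : ℕ}

/-- The uniform law on the scaled simplex. -/
noncomputable def simplexLaw (n : ℕ) : Measure (EuclideanSpace ℝ (Fin n)) :=
  (Measure.euclideanHausdorffMeasure (n - 1) : Measure (EuclideanSpace ℝ (Fin n)))[|scaledSimplex n]

theorem isClosed_scaledSimplex (n : ℕ) : IsClosed (scaledSimplex n) := by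
  have h : scaledSimplex n = (⋂ j, {x : EuclideanSpace ℝ (Fin n) | 0 ≤ x j}) ∩
      {x | ∑ j, x j = n} := by
    ext x; simp [scaledSimplex]
  rw [h]
  refine (isClosed_iInter fun j => isClosed_le continuous_const (by fun_prop)).inter
    (isClosed_eq (by fun_prop) continuous_const)

theorem le_of_mem_scaledSimplex {x : EuclideanSpace ℝ (Fin n)} (hx : x ∈ scaledSimplex n)
    (i : Fin n) : x i ≤ n := by
  rw [← hx.2]
  exact Finset.single_le_sum (fun j _ => hx.1 j) (Finset.mem_univ i)

theorem ae_simplexLaw_mem (n : ℕ) : ∀ᵐ x ∂simplexLaw n, x ∈ scaledSimplex n :=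
  ae_cond_mem (isClosed_scaledSimplex n).measurableSet

theorem MeasureTheory.MeasurePreserving.cond {α : Type*} [MeasurableSpace α] {μ : Measure α}
    {f : α → α} (hf : MeasurePreserving f μ μ) {s : Set α} (hs : MeasurableSet s)
    (h : f ⁻¹' s = s) : MeasurePreserving f (ProbabilityTheory.cond μ s)
      (ProbabilityTheory.cond μ s) := by
  have := hf.restrict_preimage hs
  rw [h] at this
  exact this.smul_measure _

/-- Permuting coordinates is an isometry, so it preserves Hausdorff measure, and it maps the simplex
to itself. -/
theorem measurePreserving_simplexLaw (σ : Equiv.Perm (Fin n)) :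
    MeasurePreserving (LinearIsometryEquiv.piLpCongrLeft 2 ℝ ℝ σ) (simplexLaw n)
      (simplexLaw n) := by
  refine MeasurePreserving.cond ((LinearIsometryEquiv.piLpCongrLeft 2 ℝ ℝ
    σ).toIsometryEquiv.measurePreserving_euclideanHausdorffMeasure _)
    (isClosed_scaledSimplex n).measurableSet ?_
  ext x
  change ((∀ j, 0 ≤ x (σ.symm j)) ∧ ∑ j, x (σ.symm j) = n) ↔ (∀ j, 0 ≤ x j) ∧ ∑ j, x j = n
  rw [Equiv.sum_comp σ.symm (fun i => x i)]
  exact and_congr_left fun _ => ⟨fun h j => by simpa using h (σ j), fun h j => h _⟩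

theorem integral_simplexLaw_perm (σ : Equiv.Perm (Fin n)) (g : (Fin n → ℝ) → ℝ) :
    ∫ x, g (fun i => x (σ i)) ∂simplexLaw n = ∫ x, g (fun i => x i) ∂simplexLaw n :=
  (measurePreserving_simplexLaw σ.symm).integral_comp
    (LinearIsometryEquiv.piLpCongrLeft 2 ℝ ℝ σ.symm).toHomeomorph.measurableEmbedding
    (fun x => g (fun i => x i))

theorem integrable_simplexLaw [IsFiniteMeasure (simplexLaw n)]
    {g : EuclideanSpace ℝ (Fin n) → ℝ} (hg : Measurable g) (C : ℝ)
    (h : ∀ x ∈ scaledSimplex n, |g x| ≤ C) : Integrable g (simplexLaw n) :=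
  Integrable.of_bound hg.aestronglyMeasurable C ((ae_simplexLaw_mem n).mono fun x hx => h x hx)

theorem integrable_simplexLaw_centered_mul [IsFiniteMeasure (simplexLaw n)] (i k : Fin n) :
    Integrable (fun x => (x i - 1) * (x k - 1)) (simplexLaw n) := by
  refine integrable_simplexLaw (by fun_prop) ((n + 1) * (n + 1)) fun x hx => ?_
  rw [abs_mul]
  have h (i) : |x i - 1| ≤ n + 1 := by
    have := hx.1 i
    have := le_of_mem_scaledSimplex hx i
    rw [abs_le]; constructor <;> linarith
  exact mul_le_mul (h i) (h k) (abs_nonneg _) (by positivity)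

theorem integrable_simplexLaw_eval [IsFiniteMeasure (simplexLaw n)] (i : Fin n) :
    Integrable (fun x => x i) (simplexLaw n) :=
  integrable_simplexLaw (by fun_prop) n fun x hx => by
    rw [abs_of_nonneg (hx.1 i)]; exact le_of_mem_scaledSimplex hx i

theorem integral_simplexLaw_eval [IsProbabilityMeasure (simplexLaw n)] (i : Fin n) :
    ∫ x, x i ∂simplexLaw n = 1 := by
  have h (k) : ∫ x, x k ∂simplexLaw n = ∫ x, x i ∂simplexLaw n := by
    simpa using integral_simplexLaw_perm (Equiv.swap i k) (fun y => y i)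
  have hs : ∑ k, ∫ x, x k ∂simplexLaw n = n := by
    rw [← integral_finsetSum _ fun k _ => integrable_simplexLaw_eval k,
      integral_congr_ae ((ae_simplexLaw_mem n).mono fun x hx => hx.2)]
    simp
  simp_rw [h] at hs
  have : (0 : ℝ) < n := by exact_mod_cast i.pos
  simp only [Finset.sum_const, Finset.card_univ, Fintype.card_fin, nsmul_eq_mul] at hs
  exact mul_left_cancel₀ this.ne' (by linarith)

theorem integral_simplexLaw_centered_sq [IsProbabilityMeasure (simplexLaw n)] (i k : Fin n) :
    ∫ x, (x i - 1) * (x i - 1) ∂simplexLaw n = ∫ x, (x k - 1) * (x k - 1) ∂simplexLaw n := by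
  simpa using (integral_simplexLaw_perm (Equiv.swap i k) (fun y => (y i - 1) * (y i - 1))).symm

/-- The centered coordinates sum to zero; multiply by `x i - 1` and integrate. By exchangeability
the `n - 1` off-diagonal terms agree. -/
theorem integral_simplexLaw_centered_mul [IsProbabilityMeasure (simplexLaw n)] {i k : Fin n}
    (hik : i ≠ k) :
    (n - 1) * ∫ x, (x i - 1) * (x k - 1) ∂simplexLaw n =
      - ∫ x, (x i - 1) * (x i - 1) ∂simplexLaw n := by
  have h (l) (hl : l ∈ Finset.univ.erase i) : ∫ x, (x i - 1) * (x l - 1) ∂simplexLaw n =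
      ∫ x, (x i - 1) * (x k - 1) ∂simplexLaw n := by
    have := integral_simplexLaw_perm (Equiv.swap k l) (fun y => (y i - 1) * (y k - 1))
    simpa [Equiv.swap_apply_of_ne_of_ne hik (Finset.ne_of_mem_erase hl).symm] using this
  have hs : ∑ l, ∫ x, (x i - 1) * (x l - 1) ∂simplexLaw n = 0 := by
    rw [← integral_finsetSum _ fun l _ => integrable_simplexLaw_centered_mul i l,
      integral_congr_ae ((ae_simplexLaw_mem n).mono fun x hx => ?_), integral_zero]
    simp only []
    rw [← Finset.mul_sum, Finset.sum_sub_distrib, hx.2]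
    simp
  rw [← Finset.add_sum_erase _ _ (Finset.mem_univ i), Finset.sum_congr rfl h, Finset.sum_const,
    Finset.card_erase_of_mem (Finset.mem_univ i), Finset.card_univ, Fintype.card_fin, nsmul_eq_mul,
    Nat.cast_sub (show 1 ≤ n from i.pos), Nat.cast_one] at hs
  linarith

/-- The corner of the simplex where `x i ≥ t n` lies in a copy of the simplex shrunk by `1 - t`
towards the vertex `n e_i`, and `(n-1)`-dimensional measure scales by `(1-t)^(n-1)`. -/
theorem simplexLaw_tail_le [IsProbabilityMeasure (simplexLaw n)] (i : Fin n) {t : ℝ}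
    (ht1 : t < 1) : (simplexLaw n).real {x | t * n ≤ x i} ≤ (1 - t) ^ (n - 1) := by
  set H : Measure (EuclideanSpace ℝ (Fin n)) := Measure.euclideanHausdorffMeasure (n - 1) with hH
  set e : EuclideanSpace ℝ (Fin n) := EuclideanSpace.single i (n : ℝ) with he
  have hsub : scaledSimplex n ∩ {x | t * n ≤ x i} ⊆
      AffineMap.homothety e (1 - t) '' scaledSimplex n := by
    rintro x ⟨hx, hxi⟩
    have h1 : (1 - t) ≠ 0 := by linarith
    have h1' : 0 < 1 - t := by linarith
    refine ⟨(1 - t)⁻¹ • (x - e) + e, ⟨fun j => ?_, ?_⟩, ?_⟩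
    · simp only [he, PiLp.add_apply, PiLp.smul_apply, PiLp.sub_apply, smul_eq_mul,
        PiLp.single_apply]
      split_ifs with hj
      · subst hj
        have : (1 - t)⁻¹ * (x j - n) + n = (1 - t)⁻¹ * (x j - t * n) := by
          field_simp; ring
        rw [this]
        exact mul_nonneg (inv_nonneg.2 h1'.le) (by simpa using hxi)
      · simpa using mul_nonneg (inv_nonneg.2 h1'.le) (hx.1 j)
    · simp [he, Finset.sum_add_distrib, ← Finset.mul_sum, hx.2, PiLp.single_apply]
    · simp [AffineMap.homothety_apply, smul_smul, h1]
  -- Conditioning on a set of measure zero or infinity would give the zero measure, so total mass 1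
  -- excludes both.
  have hpos : H (scaledSimplex n) ≠ 0 ∧ H (scaledSimplex n) ≠ ⊤ := by
    have : (simplexLaw n) Set.univ = 1 := measure_univ
    rw [simplexLaw, cond_apply (isClosed_scaledSimplex n).measurableSet, Set.inter_univ] at this
    constructor
    · intro h0; rw [← hH, h0] at this; simp at this
    · intro h0; rw [← hH, h0] at this; simp at this
  have hm := measure_mono (μ := H) hsub
  rw [hH, euclideanHausdorffMeasure_homothety_image (n - 1) e (sub_pos.2 ht1).ne', ← hH] at hm
  have hbound : simplexLaw n {x | t * n ≤ x i} ≤ (‖1 - t‖₊ ^ (n - 1) : NNReal) := by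
    rw [simplexLaw, cond_apply (isClosed_scaledSimplex n).measurableSet, ← hH]
    calc _ ≤ (H (scaledSimplex n))⁻¹ * (‖1 - t‖₊ ^ (n - 1) • H (scaledSimplex n)) := by gcongr
      _ = _ := by
        rw [ENNReal.smul_def, smul_eq_mul, mul_left_comm, ENNReal.inv_mul_cancel hpos.1 hpos.2,
          mul_one]
  have := ENNReal.toReal_mono ENNReal.coe_ne_top hbound
  simpa [Measure.real, abs_of_pos (sub_pos.2 ht1)] using this

/-- On the simplex `x i ^ 2` is at most `t n x i` below the threshold `t n` and at most `n²` above
it; the mean of `1 - 2 x i` is `-1` and is dropped. -/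
theorem integral_simplexLaw_sq_le [IsProbabilityMeasure (simplexLaw n)] (i : Fin n) {t : ℝ}
    (ht : 0 ≤ t) (ht1 : t < 1) :
    ∫ x, (x i - 1) * (x i - 1) ∂simplexLaw n ≤ t * n + n ^ 2 * (1 - t) ^ (n - 1) := by
  have hm : MeasurableSet {x : EuclideanSpace ℝ (Fin n) | t * n ≤ x i} :=
    measurableSet_le measurable_const (by fun_prop)
  have hi1 := integrable_simplexLaw_eval (n := n) i
  have hi2 : Integrable ({x : EuclideanSpace ℝ (Fin n) | t * n ≤ x i}.indicator
    (fun _ => (n : ℝ) ^ 2)) (simplexLaw n) := (integrable_const _).indicator hm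
  have hi3 : Integrable (fun x : EuclideanSpace ℝ (Fin n) => 1 - 2 * x i) (simplexLaw n) :=
    (integrable_const _).sub (hi1.const_mul _)
  have h : ∫ x, (x i - 1) * (x i - 1) ∂simplexLaw n ≤
      ∫ x, ((t * n * x i + {x : EuclideanSpace ℝ (Fin n) | t * n ≤ x i}.indicator
        (fun _ => (n : ℝ) ^ 2) x) + (1 - 2 * x i)) ∂simplexLaw n := by
    refine integral_mono_ae (integrable_simplexLaw_centered_mul i i)
      (((hi1.const_mul _).add hi2).add hi3)
      ((ae_simplexLaw_mem n).mono fun x hx => ?_)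
    have h0 := hx.1 i
    have hn := le_of_mem_scaledSimplex hx i
    simp only [Set.indicator_apply, Set.mem_ofPred_eq]
    split_ifs with hx
    · have : 0 ≤ t * n * x i := by positivity
      nlinarith
    · nlinarith
  rw [integral_add ((hi1.const_mul _).fun_add hi2) hi3,
    integral_add (hi1.const_mul _) hi2, integral_sub (integrable_const _) (hi1.const_mul _),
    integral_const_mul, integral_const_mul, integral_simplexLaw_eval, integral_const,
    integral_indicator hm, setIntegral_const] at h
  have := simplexLaw_tail_le i ht1
  simp only [probReal_univ, smul_eq_mul] at h
  nlinarith [mul_le_mul_of_nonneg_right this (sq_nonneg (n : ℝ))]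

end Simplex

/-! ### Second moment of an entry of the covariance matrix -/

section Covariance

variable {n : ℕ}

theorem covMatrix_sub_one_apply (U : Matrix.orthogonalGroup (Fin n) ℝ)
    (l : EuclideanSpace ℝ (Fin n)) (j k : Fin n) :
    covMatrix U l j k - (1 : Matrix (Fin n) (Fin n) ℝ) j k =
      ∑ i, (U : Matrix (Fin n) (Fin n) ℝ) j i * (U : Matrix (Fin n) (Fin n) ℝ) k i * (l i - 1) := by
  rw [← sum_orthogonalGroup_row_mul_row U j k, covMatrix, Matrix.mul_apply,
    ← Finset.sum_sub_distrib]
  refine Finset.sum_congr rfl fun i _ => ?_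
  rw [Matrix.mul_diagonal, Matrix.transpose_apply]
  ring

/-- The exponents 1 match the form of `integrable_orthogonalGroup_monomial`. -/
theorem covMatrix_sub_one_sq (U : Matrix.orthogonalGroup (Fin n) ℝ)
    (l : EuclideanSpace ℝ (Fin n)) (j k : Fin n) :
    (covMatrix U l j k - (1 : Matrix (Fin n) (Fin n) ℝ) j k) ^ 2 =
      ∑ p : Fin n × Fin n, (l p.1 - 1) * (l p.2 - 1) *
        ((U : Matrix (Fin n) (Fin n) ℝ) j p.1 ^ 1 * (U : Matrix (Fin n) (Fin n) ℝ) k p.1 ^ 1 *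
        ((U : Matrix (Fin n) (Fin n) ℝ) j p.2 ^ 1 * (U : Matrix (Fin n) (Fin n) ℝ) k p.2 ^ 1)) := by
  rw [covMatrix_sub_one_apply, sq, Finset.sum_mul_sum, Fintype.sum_prod_type]
  exact Finset.sum_congr rfl fun i _ => Finset.sum_congr rfl fun k _ => by ring

variable {Ω : Type*} [MeasurableSpace Ω] {P : Measure Ω} [IsProbabilityMeasure P]
  {lam : Ω → EuclideanSpace ℝ (Fin n)} {U : Ω → Matrix.orthogonalGroup (Fin n) ℝ}

theorem integral_covMatrix_sub_one_sq_le (hn : 2 ≤ n) (hlam : IsUniformOnSimplex P lam)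
    (hU : IsUniformOnOrthogonalGroup P U) (hind : IndepFun lam U P) (j k : Fin n) :
    Integrable (fun ω => (covMatrix (U ω) (lam ω) j k - (1 : Matrix (Fin n) (Fin n) ℝ) j k) ^ 2) P ∧
    ∫ ω, (covMatrix (U ω) (lam ω) j k - (1 : Matrix (Fin n) (Fin n) ℝ) j k) ^ 2 ∂P ≤
      2 * (∫ x, (x j - 1) * (x j - 1) ∂simplexLaw n) * (6 / (n + 4)) := by
  have hν : P.map lam = simplexLaw n := hlam.2
  have : IsProbabilityMeasure (simplexLaw n) :=
    hν ▸ Measure.isProbabilityMeasure_map hlam.1.aemeasurable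
  have : IsProbabilityMeasure (P.map U) := Measure.isProbabilityMeasure_map hU.1.aemeasurable
  have : (P.map U).IsHaarMeasure := hU.2
  set ρ := P.map U with hρ
  set v : ℝ := ∫ x, (x j - 1) * (x j - 1) ∂simplexLaw n with hv
  have hn1 : (1 : ℝ) ≤ n - 1 := by
    have : (2 : ℝ) ≤ n := by exact_mod_cast hn
    linarith
  let a (p : Fin n × Fin n) (V : Matrix.orthogonalGroup (Fin n) ℝ) : ℝ :=
    (V : Matrix (Fin n) (Fin n) ℝ) j p.1 ^ 1 * (V : Matrix (Fin n) (Fin n) ℝ) k p.1 ^ 1 *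
        ((V : Matrix (Fin n) (Fin n) ℝ) j p.2 ^ 1 * (V : Matrix (Fin n) (Fin n) ℝ) k p.2 ^ 1)
  let c (p : Fin n × Fin n) (x : EuclideanSpace ℝ (Fin n)) : ℝ := (x p.1 - 1) * (x p.2 - 1)
  have ha (p) : Integrable (a p) ρ := integrable_orthogonalGroup_monomial ρ j k p.1 p.2 1 1 1 1
  have hc (p) : Integrable (c p) (simplexLaw n) := integrable_simplexLaw_centered_mul p.1 p.2
  have ham (p) : Measurable (a p) := by
    have := fun q i => (continuous_orthogonalGroup_entry (n := n) q i).measurable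
    exact (((this _ _).pow_const 1).mul ((this _ _).pow_const 1)).mul
      (((this _ _).pow_const 1).mul ((this _ _).pow_const 1))
  have hcm (p) : Measurable (c p) := by fun_prop
  have hindp (p) : IndepFun (fun ω => c p (lam ω)) (fun ω => a p (U ω)) P :=
    hind.comp (hcm p) (ham p)
  have hca (p) : Integrable (fun ω => c p (lam ω) * a p (U ω)) P :=
    (hindp p).integrable_mul ((hν ▸ hc p).comp_measurable hlam.1) ((ha p).comp_measurable hU.1)
  have hprod (p) : ∫ ω, c p (lam ω) * a p (U ω) ∂P = (∫ x, c p x ∂simplexLaw n) * ∫ V, a p V ∂ρ := by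
    rw [(hindp p).integral_fun_mul_eq_mul_integral ((hcm p).comp hlam.1).aestronglyMeasurable
      ((ham p).comp hU.1).aestronglyMeasurable, ← hν, hρ,
      integral_map hlam.1.aemeasurable (hcm p).aestronglyMeasurable,
      integral_map hU.1.aemeasurable (ham p).aestronglyMeasurable]
  -- Covariance of an exchangeable vector with constant sum: `v` on the diagonal, `-v/(n-1)` off it.
  have hcp (p : Fin n × Fin n) : ∫ x, c p x ∂simplexLaw n =
      v * n / (n - 1) * (if p.1 = p.2 then 1 else 0) - v / (n - 1) := by
    obtain ⟨i, l⟩ := p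
    split_ifs with h
    · simp only at h
      subst h
      rw [integral_simplexLaw_centered_sq i j, ← hv]
      field_simp
    · have := integral_simplexLaw_centered_mul h
      rw [integral_simplexLaw_centered_sq i j, ← hv] at this
      have h0 : (n : ℝ) - 1 ≠ 0 := by linarith
      rw [mul_zero, zero_sub, ← neg_div, eq_div_iff h0, mul_comm]
      exact this
  have hv0 : 0 ≤ v := integral_nonneg fun x => mul_self_nonneg _
  have hdiag : ∑ p : Fin n × Fin n, (if p.1 = p.2 then 1 else 0) * ∫ V, a p V ∂ρ ≤ 6 / (n + 4) := by
    refine le_trans (le_of_eq ?_) (sum_integral_orthogonalGroup_sq_mul_sq_le ρ j k)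
    simp only [Fintype.sum_prod_type, ite_mul, one_mul, zero_mul, Finset.sum_ite_eq,
      Finset.mem_univ, if_true]
    refine Finset.sum_congr rfl fun i _ => integral_congr_ae (ae_of_all _ fun V => ?_)
    simp only [a]
    ring
  have hdiag0 : 0 ≤ ∑ p : Fin n × Fin n, (if p.1 = p.2 then 1 else 0) * ∫ V, a p V ∂ρ := by
    simp only [Fintype.sum_prod_type, ite_mul, one_mul, zero_mul, Finset.sum_ite_eq,
      Finset.mem_univ, if_true]
    exact Finset.sum_nonneg fun i _ => integral_nonneg fun V => mul_self_nonneg _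
  -- The double sum is the integral of the square `(∑ i, V_ji V_ki)²`, so the all-ones part enters
  -- the second moment with a favourable sign.
  have hall : 0 ≤ ∑ p : Fin n × Fin n, ∫ V, a p V ∂ρ := by
    rw [← integral_finsetSum _ fun p _ => ha p]
    refine integral_nonneg fun V => ?_
    refine (mul_self_nonneg (∑ i, (V : Matrix (Fin n) (Fin n) ℝ) j i ^ 1 *
      (V : Matrix (Fin n) (Fin n) ℝ) k i ^ 1)).trans_eq ?_
    rw [Finset.sum_mul_sum, Fintype.sum_prod_type]
  simp_rw [covMatrix_sub_one_sq]
  refine ⟨integrable_finsetSum _ fun p _ => hca p, ?_⟩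
  rw [integral_finsetSum _ fun p _ => hca p, Finset.sum_congr rfl fun p _ => hprod p]
  simp_rw [hcp, sub_mul, mul_assoc (v * n / (n - 1)), Finset.sum_sub_distrib, ← Finset.mul_sum]
  -- Uses `n ≤ 2(n - 1)`, that is, `n ≥ 2`.
  have h1 : v * n / (n - 1) ≤ 2 * v := by
    rw [div_le_iff₀ (by linarith)]
    nlinarith
  have h2 : 0 ≤ v / (n - 1) * ∑ p : Fin n × Fin n, ∫ V, a p V ∂ρ :=
    mul_nonneg (div_nonneg hv0 (by linarith)) hall
  have h3 := mul_le_mul h1 hdiag hdiag0 (by positivity)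
  linarith

/-- Chebyshev's inequality. The bound is free of `j` and `k`, which yields uniformity over the
entries. -/
theorem measure_covMatrix_sub_one_ge_le (hn : 2 ≤ n) (hlam : IsUniformOnSimplex P lam)
    (hU : IsUniformOnOrthogonalGroup P U) (hind : IndepFun lam U P) (j k : Fin n) {ε t : ℝ}
    (hε : 0 < ε) (ht : 0 ≤ t) (ht1 : t < 1) :
    P {ω | ε ≤ |covMatrix (U ω) (lam ω) j k - (1 : Matrix (Fin n) (Fin n) ℝ) j k|} ≤
      ENNReal.ofReal (12 * (t + n * (1 - t) ^ (n - 1)) / ε ^ 2) := by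
  have : IsProbabilityMeasure (simplexLaw n) :=
    (show P.map lam = simplexLaw n from hlam.2) ▸
      Measure.isProbabilityMeasure_map hlam.1.aemeasurable
  obtain ⟨hi, hle⟩ := integral_covMatrix_sub_one_sq_le hn hlam hU hind j k
  have hmarkov := mul_meas_ge_le_integral_of_nonneg (ae_of_all _ fun ω => sq_nonneg _) hi (ε ^ 2)
  have hset : {ω | ε ^ 2 ≤ (covMatrix (U ω) (lam ω) j k - (1 : Matrix (Fin n) (Fin n) ℝ) j k) ^ 2} =
      {ω | ε ≤ |covMatrix (U ω) (lam ω) j k - (1 : Matrix (Fin n) (Fin n) ℝ) j k|} := by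
    ext ω
    simp only [Set.mem_ofPred_eq]
    rw [sq_le_sq, abs_of_pos hε]
  rw [hset] at hmarkov
  have hv := integral_simplexLaw_sq_le j ht ht1
  have hn0 : (0 : ℝ) < n := by exact_mod_cast (by omega : 0 < n)
  have h1t : 0 ≤ (1 - t) ^ (n - 1) := pow_nonneg (by linarith) _
  -- Here `12 = 2 · 6`, and `n/(n+4) ≤ 1` absorbs one factor `n` of the variance bound.
  have hfin : 2 * (∫ x, (x j - 1) * (x j - 1) ∂simplexLaw n) * (6 / (n + 4)) ≤
      12 * (t + n * (1 - t) ^ (n - 1)) := by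
    rw [mul_div_assoc', div_le_iff₀ (by positivity)]
    have : 0 ≤ t + n * (1 - t) ^ (n - 1) := by positivity
    nlinarith
  rw [← ENNReal.ofReal_toReal (measure_ne_top P _)]
  refine ENNReal.ofReal_le_ofReal ?_
  rw [le_div_iff₀ (by positivity), mul_comm]
  exact hmarkov.trans (hle.trans hfin)

end Covariance

/-! ### Passage to the limit -/

theorem tendsto_nat_mul_pow_pred {r : ℝ} (hr : 0 ≤ r) (hr1 : r < 1) :
    Tendsto (fun n : ℕ => (n : ℝ) * r ^ (n - 1)) atTop (𝓝 0) := by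
  rw [← tendsto_add_atTop_iff_nat 1]
  have h := (tendsto_self_mul_const_pow_of_lt_one hr hr1).add
    (tendsto_pow_atTop_nhds_zero_of_lt_one hr hr1)
  rw [add_zero] at h
  refine h.congr fun n => ?_
  rw [Nat.add_sub_cancel]
  push_cast
  ring

theorem theorem2 {Ω : ℕ → Type*} [∀ n, MeasurableSpace (Ω n)]
    (P : ∀ n, Measure (Ω n)) [∀ n, IsProbabilityMeasure (P n)]
    (lam : ∀ n, Ω n → EuclideanSpace ℝ (Fin n))
    (U : ∀ n, Ω n → Matrix.orthogonalGroup (Fin n) ℝ)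
    (hlam : ∀ n, IsUniformOnSimplex (P n) (lam n))
    (hU : ∀ n, IsUniformOnOrthogonalGroup (P n) (U n))
    (hind : ∀ n, IndepFun (lam n) (U n) (P n))
    (ε : ℝ) (hε : 0 < ε) :
    Tendsto
      (fun n => ⨆ (j : Fin n) (k : Fin n),
        P n {ω | ε ≤ |covMatrix (U n ω) (lam n ω) j k - (1 : Matrix (Fin n) (Fin n) ℝ) j k|})
      atTop (𝓝 0) := by
  rw [ENNReal.tendsto_nhds_zero]
  intro η hη
  have hbound (t : ℝ) (ht : 0 < t) (ht1 : t < 1) :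
      Tendsto (fun n : ℕ => ENNReal.ofReal (12 * (t + n * (1 - t) ^ (n - 1)) / ε ^ 2)) atTop
        (𝓝 (ENNReal.ofReal (12 * (t + 0) / ε ^ 2))) :=
    ENNReal.tendsto_ofReal ((((tendsto_nat_mul_pow_pred (by linarith) (by linarith)).const_add
      t).const_mul 12).div_const _)
  -- For fixed `t` the bound tends to `12 t / ε²`, not to zero, so `t` is chosen before `n` to bring
  -- this limit below `η`.
  obtain ⟨t, ht, ht1, htη⟩ : ∃ t : ℝ, 0 < t ∧ t < 1 ∧
      ENNReal.ofReal (12 * (t + 0) / ε ^ 2) < η := by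
    have hcont : Tendsto (fun t : ℝ => ENNReal.ofReal (12 * (t + 0) / ε ^ 2)) (𝓝[>] 0) (𝓝 0) := by
      have : Continuous fun t : ℝ => ENNReal.ofReal (12 * (t + 0) / ε ^ 2) :=
        ENNReal.continuous_ofReal.comp (by fun_prop)
      simpa using (this.tendsto 0).mono_left nhdsWithin_le_nhds
    obtain ⟨t, h1, h2⟩ := ((hcont.eventually_lt_const hη).and
      (Ioo_mem_nhdsGT (zero_lt_one (α := ℝ)))).exists
    exact ⟨t, h2.1, h2.2, h1⟩
  filter_upwards [(hbound t ht ht1).eventually_lt_const htη, eventually_ge_atTop 2] with n h1 hn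
  exact iSup₂_le fun j k => (measure_covMatrix_sub_one_ge_le hn (hlam n) (hU n) (hind n) j k hε
    ht.le ht1).trans h1.le
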